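/- \textbf{Setting.} Let $X\subseteq\mathbb{R}^n$ be a closed set (the state space), $U\subseteq\mathbb{R}^m$ a control space, $f$ a map assigning to $x\in X$, $u\in U$ a velocity $f(x,u)\in\mathbb{R}^n$, and $F(x)=\{f(x,u):u\in U\}$ for $x\in X$. Let $\psi$ be a running cost that is continuous and positive on the graph $\{(x,v): x\in X,\ v\in F(x)\}$, and let $O\subseteq X$ be a closed obstacle set, with free space $X_{\rm free}=X\setminus O$. Closures, boundaries and continuity refer to the subspace $X$. Assume: (SH1) every $F(x)$ is nonempty and convex, the graph of $F$ is closed, and $F$ is bounded over each compact subset of $X$; (SH2) there are $\gamma,c>0$ with $\|v\|\le\gamma\|x\|+c$ for all $x\in X$, $v\in F(x)$; (SH3) for every compact $K\subseteq X$ there is $k>0$ with $F(x)\subseteq F(y)+k\|x-y\|\,\overline{B_1(0)}$ for all $x,y\in K$; (SH4) there are $\gamma',c'>0$ with $\|v\|\le(\gamma'\|x\|+c')\,\psi(x,v)$ for all $x\in X$, $v\in F(x)$ (this follows from (SH2) if $\psi$ is bounded below by a positive constant, for instance if $\psi\equiv1$). An admissible trajectory from $x$ to $y$ is an absolutely continuous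 $\pi:[0,T]\to X$, $T\ge0$, with $\pi(0)=x$, $\pi(T)=y$, $\dot\pi(t)\in F(\pi(t))$ for a.e. $t\in[0,T]$, and $\pi(t)\in\overline{X_{\rm free}}$ for all $t\in[0,T]$. Its cost is $c_\pi=\int_0^T\psi(\pi(t),\dot\pi(t))\,dt$. Let $d_c(x,y)\in[0,\infty]$ be the infimum of $c_\pi$ over all such $\pi$ ($\infty$ if there are none), and let $\mathrm{clr}(x)=\inf_{y\in O}d_c(x,y)\in[0,\infty]$ be the clearance. For $\rho>0$ put $W_\rho=\{x\in X_{\rm free}:\mathrm{clr}(x)<\rho\}$. For $x\in X_{\rm free}$ put $$\rho_{\min}(x)=\inf\{\rho>0:x\in\partial W_\rho\},\qquad \rho_{\max}(x)=\sup\{\rho>0:x\in\partial W_\rho\}$$ if $\mathrm{clr}(x)<\infty$, and $\rho_{\min}(x)=\rho_{\max}(x)=\infty$ if $\mathrm{clr}(x)=\infty$. The wave envelope is $E=\{x\in X_{\rm free}:\rho_{\min}(x)<\rho_{\max}(x)\}$. \textbf{Theorem.} Let $x\in X_{\rm free}$. Then $\mathrm{clr}$, as a function from $X$ to $[0,\infty]$,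 is discontinuous at $x$ if and only if $x\in E$. -/

import Mathlib

open Set Filter Topology MeasureTheory
open scoped ENNReal

noncomputable section

/-- The data of a controlled system with obstacles: a state space `X ⊆ ℝⁿ`, a control space
`U ⊆ ℝᵐ`, a state function `f`, a running cost `ψ` and an obstacle set inside `X`.
All topological notions (closure, interior, boundary, continuity) are those of the subspace `X`. -/
structure ControlSystem (n m : ℕ) where
  X : Set (EuclideanSpace ℝ (Fin n))
  U : Set (EuclideanSpace ℝ (Fin m))
  f : X → EuclideanSpace ℝ (Fin m) → EuclideanSpace ℝ (Fin n)
  ψ : X → EuclideanSpace ℝ (Fin n) → ℝ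
  obst : Set X

namespace ControlSystem

variable {n m : ℕ} (S : ControlSystem n m)

/-- The admissible velocities `F x = {f x u : u ∈ U}`. -/
def F (x : S.X) : Set (EuclideanSpace ℝ (Fin n)) := S.f x '' S.U

/-- The graph of the velocity multifunction. -/
def graph : Set (S.X × EuclideanSpace ℝ (Fin n)) := {p | p.2 ∈ S.F p.1}

/-- Free space. -/
def free : Set S.X := S.obstᶜ

/-- The standing hypotheses. -/
structure StandingHypotheses : Prop where
  isClosed_space : IsClosed S.X
  isClosed_obst : IsClosed S.obst
  continuousOn_cost : ContinuousOn (fun p : S.X × EuclideanSpace ℝ (Fin n) => S.ψ p.1 p.2) S.graph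
  cost_pos : ∀ x, ∀ v ∈ S.F x, 0 < S.ψ x v
  nonempty : ∀ x, (S.F x).Nonempty
  convex : ∀ x, Convex ℝ (S.F x)
  isClosed_graph : IsClosed S.graph
  locally_bounded : ∀ K : Set S.X, IsCompact K → ∃ M > 0, ∀ x ∈ K, ∀ v ∈ S.F x, ‖v‖ ≤ M
  linear_growth : ∃ γ > 0, ∃ c > 0, ∀ x : S.X, ∀ v ∈ S.F x, ‖v‖ ≤ γ * ‖(x : EuclideanSpace ℝ (Fin n))‖ + c
  /-- `F x ⊆ F y + k ‖x - y‖ B` on compact sets, with `B` the closed unit ball. -/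
  locally_lipschitz : ∀ K : Set S.X, IsCompact K → ∃ k > 0, ∀ x ∈ K, ∀ y ∈ K,
    ∀ v ∈ S.F x, ∃ w ∈ S.F y, ‖v - w‖ ≤ k * ‖(x : EuclideanSpace ℝ (Fin n)) - y‖
  /-- The linear growth condition for the velocities `v / ψ x v` of the equivalent minimal-time
  problem (automatic from `linear_growth` if `ψ` is bounded below by a positive constant). -/
  cost_linear_growth : ∃ γ > 0, ∃ c > 0, ∀ x : S.X, ∀ v ∈ S.F x,
    ‖v‖ ≤ (γ * ‖(x : EuclideanSpace ℝ (Fin n))‖ + c) * S.ψ x v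

/-- The velocity of a curve in `X`, as a vector of `ℝⁿ`. -/
def velocity (π : ℝ → S.X) (t : ℝ) : EuclideanSpace ℝ (Fin n) :=
  deriv (fun s => (π s : EuclideanSpace ℝ (Fin n))) t

/-- `π` restricted to `[0, T]` is an unconstrained trajectory from `x` to `y`: it is absolutely
continuous and solves the differential inclusion `π' ∈ F π` almost everywhere
(the values of `π` outside `[0, T]` play no role). -/
structure IsTrajectory (T : ℝ) (π : ℝ → S.X) (x y : S.X) : Prop where
  nonneg : 0 ≤ T
  absCont : AbsolutelyContinuousOnInterval π 0 T
  inclusion : ∀ᵐ t ∂(volume.restrict (Icc 0 T)),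
    DifferentiableAt ℝ (fun s => (π s : EuclideanSpace ℝ (Fin n))) t ∧ S.velocity π t ∈ S.F (π t)
  source : π 0 = x
  target : π T = y

/-- Admissible trajectories: those staying in the closure of free space. -/
structure IsAdmissible (T : ℝ) (π : ℝ → S.X) (x y : S.X) : Prop
    extends S.IsTrajectory T π x y where
  mem_closure : ∀ t ∈ Icc 0 T, π t ∈ closure S.free

/-- The cost `∫₀ᵀ ψ(π, π') dt`. The integrand is positive almost everywhere along trajectories. -/
def cost (T : ℝ) (π : ℝ → S.X) : ℝ≥0∞ :=
  ∫⁻ t in Icc 0 T, ENNReal.ofReal (S.ψ (π t) (S.velocity π t))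

/-- The cost-distance `d_c(x, y)`, equal to `∞` if no admissible trajectory joins `x` to `y`. -/
def costDist (x y : S.X) : ℝ≥0∞ :=
  ⨅ (T : ℝ) (π : ℝ → S.X) (_ : S.IsAdmissible T π x y), S.cost T π

/-- The clearance from the obstacle set. -/
def clr (x : S.X) : ℝ≥0∞ := ⨅ y ∈ S.obst, S.costDist x y

/-- The propagating wave `W_ρ`. -/
def wave (ρ : ℝ) : Set S.X := {x | x ∈ S.free ∧ S.clr x < ENNReal.ofReal ρ}

open Classical in
/-- First arrival of the wave front at `x`. -/
def rhoMin (x : S.X) : ℝ≥0∞ :=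
  if S.clr x = ⊤ then ⊤ else ⨅ (ρ : ℝ) (_ : 0 < ρ ∧ x ∈ frontier (S.wave ρ)), ENNReal.ofReal ρ

open Classical in
/-- Last arrival of the wave front at `x`. -/
def rhoMax (x : S.X) : ℝ≥0∞ :=
  if S.clr x = ⊤ then ⊤ else ⨆ (ρ : ℝ) (_ : 0 < ρ ∧ x ∈ frontier (S.wave ρ)), ENNReal.ofReal ρ

/-- The wave envelope `E`. -/
def envelope : Set S.X := {x | x ∈ S.free ∧ S.rhoMin x < S.rhoMax x}

end ControlSystem

end

/-! Since the obstacle is closed, free space is a neighbourhood of `x`. Suppose `clr x` is finite.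
If `clr` is continuous at `x`, then `x` is interior to `W_ρ` for `ρ > clr x` and off its closure for
`ρ < clr x`, so only `ρ = clr x` can be an arrival time. If `clr` jumps at `x`, every `ρ` strictly
inside the jump puts `x` on the front, and two such values separate `rhoMin` from `rhoMax`
(`not_continuousAt_clr_iff`).

If `clr x = ⊤`, then `x` is outside the envelope and continuity has to be proved: points of bounded
clearance cannot accumulate at `x` (`clr_ne_top_of_frequently`). This is a compactness argument. A
Grönwall bound driven by cost instead of time confines the trajectories to a compact set; there `ψ`
is bounded below, so their durations are bounded, and velocities are bounded, so they are
equi-Lipschitz. A limit curve is admissible because `F` has closed convex values and is locally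
Lipschitz, and it starts at `x` and ends in the obstacle. -/

/-- Post-composition with a Lipschitz map preserves absolute continuity. -/
theorem LipschitzWith.comp_absolutelyContinuousOnInterval {X Y : Type*} [PseudoMetricSpace X]
    [PseudoMetricSpace Y] {K : NNReal} {g : X → Y} (hg : LipschitzWith K g) {f : ℝ → X} {a b : ℝ}
    (hf : AbsolutelyContinuousOnInterval f a b) :
    AbsolutelyContinuousOnInterval (fun t => g (f t)) a b := by
  refine squeeze_zero (fun E => Finset.sum_nonneg fun i _ => dist_nonneg) (fun E => ?_)
    (by simpa using Tendsto.const_mul (K : ℝ) hf)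
  rw [Finset.mul_sum]
  exact Finset.sum_le_sum fun i _ => hg.dist_le_mul _ _

theorem Real.log_sub_log_le_div {a b : ℝ} (ha : 0 < a) (hb : 0 < b) :
    Real.log a - Real.log b ≤ (a - b) / b := by
  rw [← Real.log_div ha.ne' hb.ne', sub_div, div_self hb.ne']
  exact Real.log_le_sub_one_of_pos (div_pos ha hb)

/-- The factor `γ / (γ * ‖w‖ + c)` depends on the base point so that it cancels the linear growth
bound exactly in the Grönwall estimate. -/
theorem log_norm_sub_le {E : Type*} [SeminormedAddCommGroup E] {γ c : ℝ} (hγ : 0 < γ) (hc : 0 < c) (v w : E) :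
    Real.log (γ * ‖v‖ + c) - Real.log (γ * ‖w‖ + c) ≤ γ / (γ * ‖w‖ + c) * ‖v - w‖ := by
  have hw : 0 < γ * ‖w‖ + c := by positivity
  refine (Real.log_sub_log_le_div (by positivity) hw).trans ?_
  rw [div_mul_eq_mul_div]
  gcongr
  nlinarith [norm_sub_norm_le v w]

theorem lipschitzWith_log_norm {E : Type*} [SeminormedAddCommGroup E] {γ c : ℝ} (hγ : 0 < γ) (hc : 0 < c) :
    LipschitzWith (γ / c).toNNReal fun v : E => Real.log (γ * ‖v‖ + c) := by
  refine LipschitzWith.of_le_add_mul _ fun v w => ?_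
  have h := log_norm_sub_le hγ hc v w
  have : γ / (γ * ‖w‖ + c) * ‖v - w‖ ≤ γ / c * ‖v - w‖ := by
    gcongr
    nlinarith [norm_nonneg w]
  rw [Real.coe_toNNReal _ (by positivity), dist_eq_norm]
  linarith

/-! ### Absolutely continuous curves: mean velocities and Grönwall. -/

section AbsolutelyContinuous

variable {E : Type*} [NormedAddCommGroup E] [NormedSpace ℝ E]

/-- If the derivative of an absolutely continuous curve lies in a closed convex set, then so does
its mean velocity. -/
theorem AbsolutelyContinuousOnInterval.smul_sub_mem_of_deriv_mem {p : ℝ → E} {a b : ℝ}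
    (hab : a < b) (hp : AbsolutelyContinuousOnInterval p a b) {C : Set E} (hC : Convex ℝ C)
    (hC' : IsClosed C)
    (h : ∀ᵐ t ∂(volume.restrict (Icc a b)), DifferentiableAt ℝ p t ∧ deriv p t ∈ C) :
    (b - a)⁻¹ • (p b - p a) ∈ C := by
  by_contra hmem
  -- Separate the mean velocity from `C` by a functional; integrating `f (deriv p) < u` contradicts
  -- the separation.
  obtain ⟨f, u, hfu, hu⟩ := geometric_hahn_banach_closed_point hC hC' hmem
  have hg : AbsolutelyContinuousOnInterval (fun t => f (p t)) a b :=
    f.lipschitz.comp_absolutelyContinuousOnInterval hp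
  have hint := hg.integral_deriv_eq_sub
  have hle : ∫ t in a..b, deriv (fun t => f (p t)) t ≤ ∫ _ in a..b, u := by
    refine intervalIntegral.integral_mono_ae_restrict hab.le hg.intervalIntegrable_deriv
      intervalIntegrable_const ?_
    filter_upwards [h] with t ht
    have : HasDerivAt (fun t => f (p t)) (f (deriv p t)) t :=
      f.hasFDerivAt.comp_hasDerivAt t ht.1.hasDerivAt
    rw [this.deriv]
    exact (hfu _ ht.2).le
  rw [hint, intervalIntegral.integral_const, smul_eq_mul] at hle
  rw [map_smul, map_sub, smul_eq_mul, lt_inv_mul_iff₀ (sub_pos.2 hab)] at hu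
  linarith

theorem AbsolutelyContinuousOnInterval.norm_sub_le_of_norm_deriv_le {p : ℝ → E} {a b M : ℝ}
    (hab : a ≤ b) (hp : AbsolutelyContinuousOnInterval p a b)
    (h : ∀ᵐ t ∂(volume.restrict (Icc a b)), DifferentiableAt ℝ p t ∧ ‖deriv p t‖ ≤ M) :
    ‖p b - p a‖ ≤ M * (b - a) := by
  rcases hab.eq_or_lt with rfl | hab
  · simp
  have := hp.smul_sub_mem_of_deriv_mem hab (convex_closedBall (0 : E) M) Metric.isClosed_closedBall
    (by simpa using h)
  have hpos := sub_pos.2 hab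
  rw [mem_closedBall_zero_iff, norm_smul, norm_inv, Real.norm_of_nonneg hpos.le,
    inv_mul_le_iff₀ hpos] at this
  linarith

/-- Integral Grönwall bound in logarithmic form. -/
theorem AbsolutelyContinuousOnInterval.log_norm_le_add {p : ℝ → E} {a b γ c C : ℝ} {h : ℝ → ℝ}
    (hγ : 0 < γ) (hc : 0 < c) (hC : 0 ≤ C) (hab : a ≤ b) (hp : AbsolutelyContinuousOnInterval p a b)
    (hd : ∀ᵐ t ∂(volume.restrict (Icc a b)),
      DifferentiableAt ℝ p t ∧ ‖deriv p t‖ ≤ (γ * ‖p t‖ + c) * h t)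
    (hh : ∫⁻ t in Icc a b, ENNReal.ofReal (h t) ≤ ENNReal.ofReal C) :
    Real.log (γ * ‖p b‖ + c) ≤ Real.log (γ * ‖p a‖ + c) + γ * C := by
  set g : ℝ → ℝ := fun t => Real.log (γ * ‖p t‖ + c) with hg_def
  have hg : AbsolutelyContinuousOnInterval g a b :=
    (lipschitzWith_log_norm hγ hc).comp_absolutelyContinuousOnInterval hp
  have hderiv : ∀ᵐ t ∂(volume.restrict (Icc a b)), deriv g t ≤ γ * h t := by
    have hgd := hg.ae_differentiableAt
    rw [uIcc_of_le hab, ← ae_restrict_iff' measurableSet_Icc] at hgd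
    filter_upwards [hd, hgd] with t ⟨ht1, ht2⟩ ht3
    have hN : 0 < γ * ‖p t‖ + c := by positivity
    -- The norm may fail to be differentiable at `p t`, so right difference quotients are compared
    -- instead of using the chain rule.
    have key : deriv g t ≤ γ / (γ * ‖p t‖ + c) * ‖deriv p t‖ := by
      have h1 : Tendsto (slope g t) (𝓝[>] t) (𝓝 (deriv g t)) :=
        ht3.hasDerivAt.tendsto_slope.mono_left (nhdsWithin_mono _ fun s hs => ne_of_gt hs)
      have h2 : Tendsto (slope p t) (𝓝[>] t) (𝓝 (deriv p t)) :=
        ht1.hasDerivAt.tendsto_slope.mono_left (nhdsWithin_mono _ fun s hs => ne_of_gt hs)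
      refine le_of_tendsto_of_tendsto h1 (h2.norm.const_mul _) ?_
      filter_upwards [self_mem_nhdsWithin] with s hs
      have hs' : 0 < s - t := sub_pos.2 hs
      rw [slope_def_module, slope_def_module, norm_smul, norm_inv, Real.norm_of_nonneg hs'.le,
        smul_eq_mul, mul_left_comm]
      gcongr
      exact log_norm_sub_le hγ hc _ _
    refine key.trans ?_
    calc γ / (γ * ‖p t‖ + c) * ‖deriv p t‖
        ≤ γ / (γ * ‖p t‖ + c) * ((γ * ‖p t‖ + c) * h t) := by gcongr
      _ = γ * h t := by field_simp
  have hle : ∫⁻ t in Icc a b, ENNReal.ofReal (deriv g t) ≤ ENNReal.ofReal (γ * C) := by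
    calc ∫⁻ t in Icc a b, ENNReal.ofReal (deriv g t)
        ≤ ∫⁻ t in Icc a b, ENNReal.ofReal γ * ENNReal.ofReal (h t) := by
          refine lintegral_mono_ae ?_
          filter_upwards [hderiv] with t ht
          rw [← ENNReal.ofReal_mul hγ.le]
          exact ENNReal.ofReal_le_ofReal ht
      _ = ENNReal.ofReal γ * ∫⁻ t in Icc a b, ENNReal.ofReal (h t) :=
          lintegral_const_mul' _ _ ENNReal.ofReal_ne_top
      _ ≤ ENNReal.ofReal (γ * C) := by
          rw [ENNReal.ofReal_mul hγ.le]
          gcongr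
  have hint : Integrable (deriv g) (volume.restrict (Icc a b)) :=
    (intervalIntegrable_iff_integrableOn_Icc_of_le hab).1 hg.intervalIntegrable_deriv
  have heq := hg.integral_deriv_eq_sub
  rw [intervalIntegral.integral_of_le hab, ← integral_Icc_eq_integral_Ioc,
    integral_eq_lintegral_pos_part_sub_lintegral_neg_part hint] at heq
  have h3 := ENNReal.toReal_le_of_le_ofReal (by positivity) hle
  have h4 : 0 ≤ (∫⁻ t in Icc a b, ENNReal.ofReal (-deriv g t)).toReal := ENNReal.toReal_nonneg
  change g b ≤ g a + γ * C
  linarith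

end AbsolutelyContinuous

namespace ControlSystem

variable {n m : ℕ} {S : ControlSystem n m}

/-! ### A priori bounds on trajectories. -/

theorem isCompact_setOf_norm_le (hX : IsClosed S.X) (R : ℝ) :
    IsCompact {x : S.X | ‖(x : EuclideanSpace ℝ (Fin n))‖ ≤ R} := by
  have : {x : S.X | ‖(x : EuclideanSpace ℝ (Fin n))‖ ≤ R} =
      Subtype.val ⁻¹' Metric.closedBall (0 : EuclideanSpace ℝ (Fin n)) R := by
    ext x; simp
  rw [this]
  exact hX.isClosedEmbedding_subtypeVal.isCompact_preimage (isCompact_closedBall _ _)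

theorem isCompact_graph_over (hS : S.StandingHypotheses) {K : Set S.X} (hK : IsCompact K) :
    IsCompact {p ∈ S.graph | p.1 ∈ K} := by
  obtain ⟨M, -, hM⟩ := hS.locally_bounded K hK
  refine (hK.prod (isCompact_closedBall (0 : EuclideanSpace ℝ (Fin n)) M)).of_isClosed_subset
    (hS.isClosed_graph.inter (hK.isClosed.preimage continuous_fst)) ?_
  rintro ⟨x, v⟩ ⟨hv, hx⟩
  exact ⟨hx, by simpa using hM x hx v hv⟩

/-- The lower bound converts bounded cost into bounded duration; the upper bound makes the cost of a
limit trajectory finite. -/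
theorem exists_cost_bounds (hS : S.StandingHypotheses) {K : Set S.X} (hK : IsCompact K) :
    ∃ a > 0, ∃ b, ∀ x ∈ K, ∀ v ∈ S.F x, a ≤ S.ψ x v ∧ S.ψ x v ≤ b := by
  have hG := isCompact_graph_over hS hK
  have hψ := hS.continuousOn_cost.mono (sep_subset S.graph fun p => p.1 ∈ K)
  obtain ⟨a, ha, hle⟩ := hG.exists_forall_le' hψ fun p hp => hS.cost_pos p.1 p.2 hp.1
  obtain ⟨b, hb⟩ := hG.exists_bound_of_continuousOn hψ
  exact ⟨a, ha, b, fun x hx v hv => ⟨hle (x, v) ⟨hv, hx⟩,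
    (Real.le_norm_self _).trans (hb (x, v) ⟨hv, hx⟩)⟩⟩

theorem isClosed_F (hS : S.StandingHypotheses) (x : S.X) : IsClosed (S.F x) :=
  hS.isClosed_graph.preimage (Continuous.prodMk_right x)

theorem IsTrajectory.absCont_coe {T : ℝ} {π : ℝ → S.X} {x y : S.X} (h : S.IsTrajectory T π x y) :
    AbsolutelyContinuousOnInterval (fun s => (π s : EuclideanSpace ℝ (Fin n))) 0 T :=
  LipschitzWith.subtype_val S.X |>.comp_absolutelyContinuousOnInterval h.absCont

/-- Trajectories of bounded cost starting in a bounded set remain in a compact set. -/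
theorem exists_compact_of_cost_le (hS : S.StandingHypotheses) (R : ℝ) {C : ℝ} (hC : 0 ≤ C) :
    ∃ K : Set S.X, IsCompact K ∧ ∀ (T : ℝ) (π : ℝ → S.X) (x y : S.X), S.IsTrajectory T π x y →
      S.cost T π ≤ ENNReal.ofReal C → ‖(x : EuclideanSpace ℝ (Fin n))‖ ≤ R →
      ∀ t ∈ Icc 0 T, π t ∈ K := by
  obtain ⟨γ, hγ, c, hc, hgrow⟩ := hS.cost_linear_growth
  refine ⟨_, isCompact_setOf_norm_le hS.isClosed_space
    (Real.exp (Real.log (γ * R + c) + γ * C) / γ), fun T π x y h hcost hx t ht => ?_⟩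
  have hsub : Icc 0 t ⊆ Icc 0 T := Icc_subset_Icc_right ht.2
  have hlog := (h.absCont_coe.mono (by
      rwa [uIcc_of_le ht.1, uIcc_of_le h.nonneg])).log_norm_le_add
    (h := fun t => S.ψ (π t) (S.velocity π t)) hγ hc hC ht.1
    (by
      filter_upwards [ae_restrict_of_ae_restrict_of_subset hsub h.inclusion] with s hs
      exact ⟨hs.1, hgrow _ _ hs.2⟩)
    ((lintegral_mono_set hsub).trans hcost)
  rw [h.source] at hlog
  have h0 : 0 < γ * ‖(π t : EuclideanSpace ℝ (Fin n))‖ + c := by positivity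
  have hle : Real.log (γ * ‖(π t : EuclideanSpace ℝ (Fin n))‖ + c) ≤
      Real.log (γ * R + c) + γ * C := by
    refine hlog.trans ?_
    gcongr
  rw [Real.log_le_iff_le_exp h0] at hle
  rw [mem_ofPred_eq, le_div_iff₀ hγ]
  linarith

theorem IsTrajectory.mul_le_cost {T a : ℝ} {π : ℝ → S.X} {x y : S.X} (h : S.IsTrajectory T π x y)
    {K : Set S.X} (hK : ∀ t ∈ Icc 0 T, π t ∈ K) (ha : ∀ x ∈ K, ∀ v ∈ S.F x, a ≤ S.ψ x v) :
    ENNReal.ofReal a * ENNReal.ofReal T ≤ S.cost T π := by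
  have : ENNReal.ofReal a * ENNReal.ofReal T = ∫⁻ _ in Icc 0 T, ENNReal.ofReal a := by
    rw [setLIntegral_const, Real.volume_Icc, sub_zero]
  rw [this]
  refine lintegral_mono_ae ?_
  filter_upwards [h.inclusion, ae_restrict_mem measurableSet_Icc] with t ht htm
  exact ENNReal.ofReal_le_ofReal (ha _ (hK t htm) _ ht.2)

theorem IsTrajectory.cost_lt_top {T b : ℝ} {π : ℝ → S.X} {x y : S.X} (h : S.IsTrajectory T π x y)
    {K : Set S.X} (hK : ∀ t ∈ Icc 0 T, π t ∈ K) (hb : ∀ x ∈ K, ∀ v ∈ S.F x, S.ψ x v ≤ b) :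
    S.cost T π < ⊤ := by
  have : S.cost T π ≤ ∫⁻ _ in Icc 0 T, ENNReal.ofReal b := by
    refine lintegral_mono_ae ?_
    filter_upwards [h.inclusion, ae_restrict_mem measurableSet_Icc] with t ht htm
    exact ENNReal.ofReal_le_ofReal (hb _ (hK t htm) _ ht.2)
  refine this.trans_lt ?_
  rw [setLIntegral_const, Real.volume_Icc]
  exact ENNReal.mul_lt_top ENNReal.ofReal_lt_top ENNReal.ofReal_lt_top

/-- An admissible trajectory with velocities bounded by `M` can be made globally `M`-Lipschitz by
freezing it outside its time interval. -/
theorem IsAdmissible.exists_lipschitz {T : ℝ} {π : ℝ → S.X} {x y : S.X}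
    (h : S.IsAdmissible T π x y) {K : Set S.X} (hK : ∀ t ∈ Icc 0 T, π t ∈ K) {M : NNReal}
    (hM : ∀ x ∈ K, ∀ v ∈ S.F x, ‖v‖ ≤ M) :
    ∃ q : ℝ → S.X, S.IsAdmissible T q x y ∧ LipschitzWith M q ∧
      ∀ t, q t ∈ K ∩ closure S.free := by
  have hT := h.nonneg
  have hπ : LipschitzOnWith M π (Icc 0 T) := by
    have key : ∀ s ∈ Icc 0 T, ∀ t ∈ Icc 0 T, s ≤ t → dist (π t) (π s) ≤ M * dist t s := by
      intro s hs t ht hst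
      have hsub : Icc s t ⊆ Icc 0 T := Icc_subset_Icc hs.1 ht.2
      have := (h.absCont_coe.mono (by
        rwa [uIcc_of_le hst, uIcc_of_le hT])).norm_sub_le_of_norm_deriv_le (M := M) hst (by
          filter_upwards [ae_restrict_of_ae_restrict_of_subset hsub h.inclusion,
            ae_restrict_mem measurableSet_Icc] with r hr hrm
          exact ⟨hr.1, hM _ (hK r (hsub hrm)) _ hr.2⟩)
      rwa [Subtype.dist_eq, dist_eq_norm, Real.dist_eq, abs_of_nonneg (sub_nonneg.2 hst)]
    refine LipschitzOnWith.of_dist_le_mul fun s hs t ht => ?_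
    rcases le_total s t with hst | hst
    · rw [dist_comm, dist_comm s]
      exact key s hs t ht hst
    · exact key t ht s hs hst
  have hproj : LipschitzWith 1 fun t => (projIcc 0 T hT t : ℝ) :=
    (LipschitzWith.subtype_val _).comp (LipschitzWith.projIcc hT) |>.weaken (by simp)
  set q : ℝ → S.X := fun t => π (projIcc 0 T hT t) with hq
  have hqeq : ∀ t ∈ Icc 0 T, q t = π t := fun t ht => by simp only [hq, projIcc_of_mem hT ht]
  have hqL : LipschitzWith M q := by
    have := hπ.comp (hproj.lipschitzOnWith (s := univ)) fun t _ => (projIcc 0 T hT t).2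
    rw [mul_one] at this
    exact lipschitzOnWith_univ.1 this
  refine ⟨q, ⟨⟨hT, hqL.lipschitzOnWith.absolutelyContinuousOnInterval, ?_, ?_, ?_⟩, ?_⟩, hqL, ?_⟩
  · have hend : ∀ᵐ t ∂(volume.restrict (Icc 0 T)), t ∈ Ioo 0 T := by
      rw [← restrict_Ioo_eq_restrict_Icc]
      exact ae_restrict_mem measurableSet_Ioo
    filter_upwards [h.inclusion, hend] with t ht htm
    have hev : (fun s => (q s : EuclideanSpace ℝ (Fin n))) =ᶠ[𝓝 t] fun s => π s := by
      filter_upwards [Ioo_mem_nhds htm.1 htm.2] with s hs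
      rw [hqeq s (Ioo_subset_Icc_self hs)]
    refine ⟨hev.differentiableAt_iff.2 ht.1, ?_⟩
    rw [velocity, hev.deriv_eq, hqeq t (Ioo_subset_Icc_self htm)]
    exact ht.2
  · rw [hqeq 0 (left_mem_Icc.2 hT), h.source]
  · rw [hqeq T (right_mem_Icc.2 hT), h.target]
  · exact fun t ht => by rw [hqeq t ht]; exact h.mem_closure t ht
  · exact fun t => ⟨hK _ (projIcc 0 T hT t).2, h.mem_closure _ (projIcc 0 T hT t).2⟩

/-! ### Compactness of trajectories and infinite clearance. -/

/-- Pointwise limits of equi-Lipschitz solutions of the differential inclusion are solutions. -/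
theorem ae_velocity_mem_of_tendsto (hS : S.StandingHypotheses) {ι : Type*} {l : Filter ι}
    [l.NeBot] {T : ι → ℝ} {τ : ℝ} {q : ι → ℝ → S.X} {π : ℝ → S.X} {K : Set S.X} (hK : IsCompact K)
    (hqK : ∀ i t, q i t ∈ K) (hπK : ∀ t, π t ∈ K) {M : NNReal}
    (hqL : ∀ i, LipschitzWith M (q i)) (hπL : LipschitzWith M π)
    (hincl : ∀ i, ∀ᵐ t ∂(volume.restrict (Icc 0 (T i))),
      DifferentiableAt ℝ (fun s => (q i s : EuclideanSpace ℝ (Fin n))) t ∧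
        S.velocity (q i) t ∈ S.F (q i t))
    (hT : Tendsto T l (𝓝 τ)) (hq : ∀ t, Tendsto (fun i => q i t) l (𝓝 (π t))) :
    ∀ᵐ t ∂(volume.restrict (Icc 0 τ)),
      DifferentiableAt ℝ (fun s => (π s : EuclideanSpace ℝ (Fin n))) t ∧
        S.velocity π t ∈ S.F (π t) := by
  obtain ⟨k, hk, hLip⟩ := hS.locally_lipschitz K hK
  have hdiff : ∀ᵐ t, DifferentiableAt ℝ (fun s => (π s : EuclideanSpace ℝ (Fin n))) t :=
    ((LipschitzWith.subtype_val S.X).comp hπL).ae_differentiableAt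
  have hend : ∀ᵐ t ∂(volume.restrict (Icc 0 τ)), t ∈ Ioo 0 τ := by
    rw [← restrict_Ioo_eq_restrict_Icc]
    exact ae_restrict_mem measurableSet_Ioo
  filter_upwards [ae_restrict_of_ae hdiff, hend] with t ht htm
  refine ⟨ht, ?_⟩
  -- As `F (π t)` is closed, it suffices to reach each of its closed `ε`-thickenings. These are
  -- convex, so they contain the mean velocities of `q i` over short intervals, hence the limits of
  -- these.
  rw [← (isClosed_F hS (π t)).closure_eq, Metric.closure_eq_iInter_cthickening]
  refine mem_iInter₂.2 fun ε hε => ?_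
  have hslope : Tendsto (slope (fun s => (π s : EuclideanSpace ℝ (Fin n))) t) (𝓝[>] t)
      (𝓝 (S.velocity π t)) :=
    ht.hasDerivAt.tendsto_slope.mono_left (nhdsWithin_mono _ fun s hs => ne_of_gt hs)
  refine Metric.isClosed_cthickening.mem_of_tendsto hslope ?_
  -- Half of `ε` pays for the motion of `q i` during time `δ`, the other half for the distance from
  -- `q i t` to `π t`; both are multiplied by `k`.
  set δ : ℝ := ε / (2 * (k * M + 1)) with hδ_def
  have hkM : 0 ≤ k * (M : ℝ) := by positivity
  have hδ : 0 < δ := by positivity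
  have hkδ : k * (M * δ) ≤ ε / 2 := by
    rw [hδ_def, ← mul_assoc, mul_div_assoc', div_le_div_iff₀ (by positivity) two_pos]
    nlinarith
  filter_upwards [Ioo_mem_nhdsGT (lt_min (lt_add_of_pos_right t hδ) htm.2)] with s hs
  have hsτ : s < τ := hs.2.trans_le (min_le_right _ _)
  have hsδ : s < t + δ := hs.2.trans_le (min_le_left _ _)
  have hlim : Tendsto
      (fun i => slope (fun s => (q i s : EuclideanSpace ℝ (Fin n))) t s) l
      (𝓝 (slope (fun s => (π s : EuclideanSpace ℝ (Fin n))) t s)) := by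
    simp only [slope_def_module]
    exact (((continuous_subtype_val.tendsto _).comp (hq s)).sub
      ((continuous_subtype_val.tendsto _).comp (hq t))).const_smul _
  refine Metric.isClosed_cthickening.mem_of_tendsto hlim ?_
  have hclose : ∀ᶠ i in l, dist (q i t) (π t) < ε / (2 * k) :=
    (tendsto_iff_dist_tendsto_zero.1 (hq t)).eventually_lt_const (by positivity)
  filter_upwards [hclose, hT.eventually_const_lt hsτ] with i hi hTi
  have hsub : Icc t s ⊆ Icc 0 (T i) := Icc_subset_Icc htm.1.le hTi.le
  rw [slope_def_module]
  refine AbsolutelyContinuousOnInterval.smul_sub_mem_of_deriv_mem hs.1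
    ((LipschitzWith.subtype_val S.X).comp (hqL i)).lipschitzOnWith.absolutelyContinuousOnInterval
    ((hS.convex _).cthickening ε) Metric.isClosed_cthickening ?_
  filter_upwards [ae_restrict_of_ae_restrict_of_subset hsub (hincl i),
    ae_restrict_mem measurableSet_Icc] with r hr hrm
  refine ⟨hr.1, ?_⟩
  obtain ⟨w, hw, hvw⟩ := hLip _ (hqK i r) _ (hπK t) _ hr.2
  refine Metric.mem_cthickening_of_dist_le _ w _ _ hw ?_
  have hdist : dist (q i r) (π t) ≤ M * δ + ε / (2 * k) := by
    refine (dist_triangle _ (q i t) _).trans (add_le_add ?_ hi.le)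
    refine ((hqL i).dist_le_mul r t).trans ?_
    gcongr
    rw [Real.dist_eq, abs_of_nonneg (sub_nonneg.2 hrm.1)]
    linarith [hrm.2]
  rw [Subtype.dist_eq, dist_eq_norm] at hdist
  rw [dist_eq_norm]
  calc ‖S.velocity (q i) r - w‖ ≤ k * (M * δ + ε / (2 * k)) := hvw.trans (by gcongr)
    _ = k * (M * δ) + ε / 2 := by field_simp
    _ ≤ ε := by linarith

/-- A point which is a limit of points of bounded clearance has finite clearance. -/
theorem clr_ne_top_of_frequently (hS : S.StandingHypotheses) {x : S.X} {C : ℝ} (hC : 0 ≤ C)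
    (hfr : ∃ᶠ y in 𝓝 x, S.clr y < ENNReal.ofReal C) : S.clr x ≠ ⊤ := by
  obtain ⟨K, hK, hKmem⟩ :=
    exists_compact_of_cost_le hS (‖(x : EuclideanSpace ℝ (Fin n))‖ + 1) hC
  obtain ⟨M, hM0, hM⟩ := hS.locally_bounded K hK
  lift M to NNReal using hM0.le
  obtain ⟨a, ha, b, hab⟩ := exists_cost_bounds hS hK
  have hnorm : ∀ᶠ y : S.X in 𝓝 x, ‖(y : EuclideanSpace ℝ (Fin n))‖ <
      ‖(x : EuclideanSpace ℝ (Fin n))‖ + 1 :=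
    (continuous_subtype_val.norm.tendsto x).eventually_lt_const (lt_add_one _)
  set A : Set S.X := {y | ∃ z ∈ S.obst, ∃ T ∈ Icc 0 (C / a), ∃ q : ℝ → S.X,
    S.IsAdmissible T q y z ∧ LipschitzWith M q ∧ ∀ t, q t ∈ K ∩ closure S.free} with hA
  have hfrA : ∃ᶠ y in 𝓝 x, y ∈ A := by
    refine (hfr.and_eventually hnorm).mono fun y ⟨hy, hyn⟩ => ?_
    simp only [clr, costDist, iInf_lt_iff] at hy
    obtain ⟨z, hz, T, π, hπ, hcost⟩ := hy
    have hmem := hKmem T π y z hπ.toIsTrajectory hcost.le hyn.le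
    obtain ⟨q, hq⟩ := hπ.exists_lipschitz hmem hM
    refine ⟨z, hz, T, ⟨hπ.nonneg, ?_⟩, q, hq⟩
    have h1 := (hπ.mul_le_cost hmem fun x hx v hv => (hab x hx v hv).1).trans hcost.le
    rw [← ENNReal.ofReal_mul ha.le, ENNReal.ofReal_le_ofReal_iff hC] at h1
    rw [le_div_iff₀ ha]
    linarith
  have hne : (comap ((↑) : A → S.X) (𝓝 x)).NeBot := by
    rw [comap_neBot_iff_frequently]
    simpa using hfrA
  -- Along an ultrafilter the curves converge at every time simultaneously, without extracting
  -- subsequences.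
  let l : Ultrafilter A := Ultrafilter.of (comap ((↑) : A → S.X) (𝓝 x))
  have hl : Tendsto ((↑) : A → S.X) l (𝓝 x) :=
    tendsto_comap.mono_left (Ultrafilter.of_le _)
  choose z hz T hT q hadm hqL hqK using fun y : A => y.2
  obtain ⟨τ, hτ, hTτ⟩ := isCompact_Icc.ultrafilter_le_nhds' (l.map T)
    (Ultrafilter.mem_map.2 (univ_mem' hT))
  have hpt : ∀ t, ∃ w ∈ K ∩ closure S.free, Tendsto (fun i => q i t) l (𝓝 w) := fun t =>
    (hK.inter_right isClosed_closure).ultrafilter_le_nhds' (l.map fun i => q i t)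
      (Ultrafilter.mem_map.2 (univ_mem' fun i => hqK i t))
  choose π hπK hπ using hpt
  have hπL : LipschitzWith M π := LipschitzWith.of_dist_le_mul fun s t =>
    le_of_tendsto ((hπ s).dist (hπ t)) (Eventually.of_forall fun i => (hqL i).dist_le_mul s t)
  have hincl := ae_velocity_mem_of_tendsto (l := (l : Filter A)) hS hK (fun i t => (hqK i t).1)
    (fun t => (hπK t).1) hqL hπL (fun i => (hadm i).inclusion) hTτ hπ
  have hsource : π 0 = x :=
    tendsto_nhds_unique (hπ 0) (hl.congr fun i => (hadm i).source.symm)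
  have htarget : π τ ∈ S.obst := by
    have hz_lim : Tendsto z l (𝓝 (π τ)) := by
      rw [tendsto_iff_dist_tendsto_zero]
      have h0 : Tendsto (fun i => M * dist (T i) τ + dist (q i τ) (π τ)) l (𝓝 (M * 0 + 0)) :=
        ((tendsto_iff_dist_tendsto_zero.1 hTτ).const_mul _).add
          (tendsto_iff_dist_tendsto_zero.1 (hπ τ))
      rw [mul_zero, add_zero] at h0
      refine squeeze_zero (fun _ => dist_nonneg) (fun i => ?_) h0
      refine (dist_triangle _ (q i τ) _).trans (add_le_add_left ?_ _)
      rw [← (hadm i).target]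
      exact (hqL i).dist_le_mul _ _
    exact hS.isClosed_obst.mem_of_tendsto hz_lim (Eventually.of_forall hz)
  have hlim : S.IsAdmissible τ π x (π τ) :=
    ⟨⟨hτ.1, hπL.lipschitzOnWith.absolutelyContinuousOnInterval, hincl, hsource, rfl⟩,
      fun t _ => (hπK t).2⟩
  -- Only finiteness is needed, so no semicontinuity of the cost enters.
  refine ne_top_of_le_ne_top
    (hlim.cost_lt_top (fun t _ => (hπK t).1) fun x hx v hv => (hab x hx v hv).2).ne ?_
  exact (iInf₂_le (π τ) htarget).trans (iInf_le_of_le τ (iInf₂_le π hlim))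

theorem continuousAt_clr_of_eq_top (hS : S.StandingHypotheses) {x : S.X} (hx : S.clr x = ⊤) :
    ContinuousAt S.clr x := by
  rw [ContinuousAt, hx, ENNReal.tendsto_nhds_top_iff_nnreal]
  intro r
  by_contra h
  refine clr_ne_top_of_frequently hS (C := r + 1) (by positivity) ?_ hx
  refine (not_eventually.1 h).mono fun y hy => (not_lt.1 hy).trans_lt ?_
  rw [← ENNReal.ofReal_coe_nnreal, ENNReal.ofReal_lt_ofReal_iff (by positivity)]
  exact lt_add_one _

/-! ### Wave fronts and jumps of the clearance. -/

theorem exists_ofReal_between {a b : ℝ≥0∞} (h : a < b) :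
    ∃ ρ₁ ρ₂ : ℝ, 0 < ρ₁ ∧ 0 < ρ₂ ∧ a < ENNReal.ofReal ρ₁ ∧
      ENNReal.ofReal ρ₁ < ENNReal.ofReal ρ₂ ∧ ENNReal.ofReal ρ₂ < b := by
  obtain ⟨r, har, hrb⟩ := exists_between h
  obtain ⟨q, hrq, hqb⟩ := exists_between hrb
  have hq : q ≠ ⊤ := hqb.ne_top
  have hr : r ≠ ⊤ := hrb.ne_top
  refine ⟨r.toReal, q.toReal, ENNReal.toReal_pos (pos_of_gt har).ne' hr,
    ENNReal.toReal_pos (pos_of_gt hrq).ne' hq, ?_⟩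
  rw [ENNReal.ofReal_toReal hq, ENNReal.ofReal_toReal hr]
  exact ⟨har, hrq, hqb⟩

theorem rhoMin_lt_rhoMax_of_frontier {x : S.X} (hx : S.clr x ≠ ⊤) {ρ₁ ρ₂ : ℝ} (h₁ : 0 < ρ₁)
    (h₂ : 0 < ρ₂) (h : ENNReal.ofReal ρ₁ < ENNReal.ofReal ρ₂) (hf₁ : x ∈ frontier (S.wave ρ₁))
    (hf₂ : x ∈ frontier (S.wave ρ₂)) : S.rhoMin x < S.rhoMax x := by
  rw [rhoMin, rhoMax, if_neg hx, if_neg hx]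
  exact (iInf₂_le ρ₁ ⟨h₁, hf₁⟩).trans_lt (h.trans_le
    (le_iSup₂ (f := fun (ρ : ℝ) (_ : 0 < ρ ∧ x ∈ frontier (S.wave ρ)) => ENNReal.ofReal ρ)
      ρ₂ ⟨h₂, hf₂⟩))

/-- Where the clearance is finite and continuous, only the wave front at time `clr x` can
contain `x`. -/
theorem ofReal_eq_clr_of_mem_frontier {x : S.X} (hfree : S.free ∈ 𝓝 x)
    (hc : ContinuousAt S.clr x) {ρ : ℝ} (hf : x ∈ frontier (S.wave ρ)) :
    ENNReal.ofReal ρ = S.clr x := by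
  refine le_antisymm (le_of_not_gt fun hlt => hf.2 ?_) (le_of_not_gt fun hlt => ?_)
  · rw [mem_interior_iff_mem_nhds]
    filter_upwards [hfree, hc.eventually_lt_const hlt] with y hy hy' using ⟨hy, hy'⟩
  · obtain ⟨y, hy, hy'⟩ := ((mem_closure_iff_frequently.1 hf.1).and_eventually
      (hc.eventually_const_lt hlt)).exists
    exact lt_asymm hy.2 hy'

theorem not_continuousAt_clr_iff {x : S.X} (hfree : S.free ∈ 𝓝 x) (hx : S.clr x ≠ ⊤) :
    ¬ ContinuousAt S.clr x ↔ S.rhoMin x < S.rhoMax x := by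
  have hxf : x ∈ S.free := mem_of_mem_nhds hfree
  constructor
  · intro hc
    rw [ContinuousAt, tendsto_order, not_and_or] at hc
    push Not at hc
    rcases hc with ⟨a, ha, hfr⟩ | ⟨a, ha, hfr⟩
    -- Downward jump: for `ρ` between `a` and `clr x`, `x` is a limit of points of the wave but not
    -- in it.
    · obtain ⟨ρ₁, ρ₂, h₁, h₂, ha₁, h₁₂, hc₂⟩ := exists_ofReal_between ha
      have key : ∀ ρ : ℝ, a < ENNReal.ofReal ρ → ENNReal.ofReal ρ < S.clr x →
          x ∈ frontier (S.wave ρ) := fun ρ haρ hρ => by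
        refine ⟨mem_closure_iff_frequently.2 ?_, fun hint => lt_asymm hρ (interior_subset hint).2⟩
        refine (hfr.and_eventually hfree).mono fun y hy => ⟨hy.2, lt_of_le_of_lt ?_ haρ⟩
        simpa using hy.1
      exact rhoMin_lt_rhoMax_of_frontier hx h₁ h₂ h₁₂ (key _ ha₁ (h₁₂.trans hc₂))
        (key _ (ha₁.trans h₁₂) hc₂)
    -- Upward jump: for `ρ` between `clr x` and `a`, `x` is in the wave but not in its interior.
    · obtain ⟨ρ₁, ρ₂, h₁, h₂, hc₁, h₁₂, ha₂⟩ := exists_ofReal_between ha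
      have key : ∀ ρ : ℝ, S.clr x < ENNReal.ofReal ρ → ENNReal.ofReal ρ < a →
          x ∈ frontier (S.wave ρ) := fun ρ hρ haρ => by
        refine ⟨subset_closure ⟨hxf, hρ⟩, fun hint => ?_⟩
        obtain ⟨y, hy, hy'⟩ := (hfr.and_eventually (mem_interior_iff_mem_nhds.1 hint)).exists
        exact lt_asymm hy'.2 (haρ.trans_le (by simpa using hy))
      exact rhoMin_lt_rhoMax_of_frontier hx h₁ h₂ h₁₂ (key _ hc₁ (h₁₂.trans ha₂))
        (key _ (hc₁.trans h₁₂) ha₂)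
  · intro hlt hc
    rw [rhoMin, rhoMax, if_neg hx, if_neg hx] at hlt
    -- Both bounds hold vacuously if no front meets `x`: the supremum is then `0` and the infimum
    -- `⊤`.
    refine hlt.not_ge ((iSup₂_le fun ρ hρ => ?_).trans (le_iInf₂ (a := S.clr x) fun ρ hρ => ?_))
    · exact (ofReal_eq_clr_of_mem_frontier hfree hc hρ.2).le
    · exact (ofReal_eq_clr_of_mem_frontier hfree hc hρ.2).ge

end ControlSystem

theorem mainTheorem2 {n m : ℕ} (S : ControlSystem n m) (hS : S.StandingHypotheses)
    (x : S.X) (hx : x ∈ S.free) :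
    ¬ ContinuousAt S.clr x ↔ x ∈ S.envelope := by
  have hfree : S.free ∈ 𝓝 x := hS.isClosed_obst.isOpen_compl.mem_nhds hx
  rw [ControlSystem.envelope, mem_ofPred_eq, and_iff_right hx]
  by_cases htop : S.clr x = ⊤
  · have hE : ¬ S.rhoMin x < S.rhoMax x := by
      rw [ControlSystem.rhoMin, if_pos htop]
      exact not_top_lt
    exact iff_of_false (not_not.2 (ControlSystem.continuousAt_clr_of_eq_top hS htop)) hE
  · exact ControlSystem.not_continuousAt_clr_iff hfree htop
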